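/- Consider the following sequential social learning model. A state $\theta\in\{\mathfrak g,\mathfrak b\}$ is drawn with equal probabilities, and independently a state $\omega\in\{0,1\}$ is drawn with $\mathbb P[\omega=1]=\gamma\in(0,1)$. Agents $t=1,2,\dots$ act in order. Agent $t$ observes the history $H_t=(a_1,\dots,a_{t-1})$ of her predecessors' actions and a private signal $s_t\in\mathbb R$, and chooses an action $a_t\in\{\mathfrak g,\mathfrak b\}$ as a measurable function of $(H_t,s_t)$; her payoff is $1$ if $a_t=\theta$ and $0$ otherwise. Conditionally on $(\omega,\theta)$ the signals are i.i.d.: if $\omega=1$ (informative source) their law is $\mathcal N(m_\theta,\sigma^2)$, where $m_{\mathfrak g}\neq m_{\mathfrak b}$; if $\omega=0$ (uninformative source) their law is $\mathcal N(m_0,\tau^2)$, irrespective of $\theta$. Here $m_{\mathfrak g},m_{\mathfrak b},m_0\in\mathbb R$ and $\sigma,\tau>0$. Agents play a Bayesian Nash equilibrium, that is, for every $t$, almost surely $a_t\in\operatorname{argmax}_{a\in\{\mathfrak g,\mathfrak b\}}\mathbb P[\theta=a\mid H_t,s_t]$. Let $q_t=\mathbb P[\omega=1\mid H_t]$. Asymptotic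 learning of informativeness is said to hold if, for each $i\in\{0,1\}$, $\lim_{t\to\infty}q_t=i$ almost surely with respect to $\mathbb P[\,\cdot\mid\omega=i]$. Then, in every equilibrium, asymptotic learning of informativeness holds if $\tau>\sigma$ and fails if $\tau<\sigma$. -/

import Mathlib

open MeasureTheory ProbabilityTheory Filter Topology
open scoped NNReal ENNReal

noncomputable section

namespace SocialLearning

/-- The payoff-relevant state, and also the set of actions: `true` is the good state, `false` the
bad state. -/
abbrev State := Bool

/-- The state of the source: `true` means informative, `false` means uninformative. -/
abbrev Source := Bool

/-- The conditional law of one signal given the source and the payoff-relevant state. -/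
def signalLaw {S : Type*} [MeasurableSpace S] (μg μb μ0 : Measure S) :
    Source → State → Measure S
  | true, true => μg
  | true, false => μb
  | false, _ => μ0

/-- The primitives of the model on a probability space `(Ω, P)`: a payoff-relevant state `θ` with
uniform prior, an independent source state `ω` which is informative with probability `γ`, and
signals `s 0, s 1, …` that are conditionally i.i.d. given `(ω, θ)`, with law `μg` or `μb`
(according to `θ`) if the source is informative and with law `μ0` if it is uninformative. -/
structure IsModel {Ω S : Type*} [MeasurableSpace Ω] [MeasurableSpace S] (P : Measure Ω)
    (γ : ℝ) (μg μb μ0 : Measure S) (θ : Ω → State) (ω : Ω → Source) (s : ℕ → Ω → S) : Prop where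
  measurable_state : Measurable θ
  measurable_source : Measurable ω
  measurable_signal : ∀ t, Measurable (s t)
  prior_state : ∀ a : State, P {x | θ x = a} = 1 / 2
  prior_source : P {x | ω x = true} = ENNReal.ofReal γ
  indep : IndepFun θ ω P
  signal_indep : ∀ (i : Source) (a : State), iIndepFun s (P[|{x | ω x = i ∧ θ x = a}])
  signal_law : ∀ (i : Source) (a : State) (t : ℕ),
    (P[|{x | ω x = i ∧ θ x = a}]).map (s t) = signalLaw μg μb μ0 i a

/-- A pure strategy profile: agent `t` (agents are numbered from `0`) chooses an action as a
measurable function of the actions of her `t` predecessors and of her private signal. -/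
structure StrategyProfile (S : Type*) [MeasurableSpace S] where
  choose : (t : ℕ) → (Fin t → State) × S → State
  measurable_choose : ∀ t, Measurable (choose t)

/-- The history (the actions of agents `0, …, t - 1`) that a strategy profile generates from a
realization of the signals. -/
def history {S : Type*} [MeasurableSpace S] (f : StrategyProfile S) (s : ℕ → S) :
    (t : ℕ) → (Fin t → State)
  | 0 => Fin.elim0
  | t + 1 => Fin.snoc (α := fun _ => State) (history f s t) (f.choose t (history f s t, s t))

/-- The action of agent `t`. -/
def action {S : Type*} [MeasurableSpace S] (f : StrategyProfile S) (s : ℕ → S) (t : ℕ) : State :=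
  f.choose t (history f s t, s t)

section

variable {Ω S : Type*} [MeasurableSpace Ω] [MeasurableSpace S]

/-- The information of the outside observer: the σ-algebra generated by the history. -/
abbrev publicInfo (f : StrategyProfile S) (s : ℕ → Ω → S) (t : ℕ) : MeasurableSpace Ω :=
  MeasurableSpace.comap (fun x => history f (fun k => s k x) t) inferInstance

/-- The information of agent `t`: the σ-algebra generated by the history and her signal. -/
abbrev agentInfo (f : StrategyProfile S) (s : ℕ → Ω → S) (t : ℕ) : MeasurableSpace Ω :=
  MeasurableSpace.comap (fun x => (history f (fun k => s k x) t, s t x)) inferInstance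

/-- The expected payoff of agent `t` from action `a` conditioned on her information. -/
def expectedPayoff (P : Measure Ω) (θ : Ω → State) (s : ℕ → Ω → S) (f : StrategyProfile S)
    (t : ℕ) (a : State) : Ω → ℝ :=
  P[Set.indicator {x | θ x = a} (fun _ => (1 : ℝ)) | agentInfo f s t]

/-- Bayesian Nash equilibrium: almost surely, every agent's action maximizes her expected payoff
conditioned on her information. (An agent's payoff depends on no action but her own, and her
information depends only on the strategies of her predecessors.) -/
def IsEquilibrium (P : Measure Ω) (θ : Ω → State) (s : ℕ → Ω → S)
    (f : StrategyProfile S) : Prop :=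
  ∀ t : ℕ, ∀ᵐ x ∂P, ∀ a : State,
    expectedPayoff P θ s f t a x ≤ expectedPayoff P θ s f t (action f (fun k => s k x) t) x

/-- The outside observer's belief that the source is informative, given the history. -/
def observerBelief (P : Measure Ω) (ω : Ω → Source) (s : ℕ → Ω → S) (f : StrategyProfile S)
    (t : ℕ) : Ω → ℝ :=
  P[Set.indicator {x | ω x = true} (fun _ => (1 : ℝ)) | publicInfo f s t]

/-- Asymptotic learning of informativeness: conditioned on either state of the source, the
observer's belief converges almost surely to the truth. -/
def AsymptoticLearning (P : Measure Ω) (ω : Ω → Source) (s : ℕ → Ω → S)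
    (f : StrategyProfile S) : Prop :=
  ∀ i : Source, ∀ᵐ x ∂(P[|{x | ω x = i}]),
    Tendsto (fun t => observerBelief P ω s f t x) atTop (𝓝 (if i = true then 1 else 0))

end

end SocialLearning

end

namespace SocialLearning

/-! ### Gaussian laws and likelihood ratio regions -/

section Gaussian

/-! An uninformative source adds the same amount to the payoff of either action, so an agent in
equilibrium compares the two states as if the source were informative. Along a fixed action sequence
`c` the likelihoods of the first `t` actions therefore obey a deterministic recursion
(`IsThresholdPath`, obtained in `IsModel.isThresholdPath`): each factor is the probability that the
signal falls in a region cut out by a likelihood ratio threshold. For Gaussians of equal variance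
that region is a half-line, so it has positive probability under every nondegenerate Gaussian. A
Gaussian density is at most a constant times any Gaussian density of larger variance, and this
decides which source produces contrarian signals more easily.

Case `σ < τ`. If some action sequence had positive probability under the uninformative source, its
deviation probabilities would be summable there, hence by domination also under both informative
laws. The likelihood ratios of the states would then stay bounded, and deviations could not become
rare: a contradiction (`exists_lt`). Eventually constant sequences are countably many, so actions
almost surely do not converge under the uninformative source. Under the informative source the
belief about `θ` is a convergent martingale, while infinitely many switches would force its limit to
be 1/2, where every action still moves it by a definite amount (`exists_eventually_eq`). So
convergence of actions reveals the source, and Lévy's upward theorem gives learning.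

Case `τ < σ`. Along a constant sequence the deviation probabilities under the informative source in
the matching state are summable by a telescoping estimate, and domination, now in the other
direction, carries this to the uninformative source (`exists_le_of_const`). The herd thus has
positive probability under both sources, and on it the observer's belief stays bounded away from 0.
-/

lemma gaussianReal_real_eq_setIntegral (m : ℝ) {v : ℝ≥0} (hv : v ≠ 0) (S : Set ℝ) :
    (gaussianReal m v).real S = ∫ x in S, gaussianPDFReal m v x := by
  rw [measureReal_def, gaussianReal_apply_eq_integral m hv, ENNReal.toReal_ofReal]
  exact integral_nonneg fun x => gaussianPDFReal_nonneg m v x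

/-- Pointwise comparison of Gaussian densities on a set gives comparison of its probabilities. -/
lemma gaussianReal_real_le_mul {m m' : ℝ} {v w : ℝ≥0} (hv : v ≠ 0) (hw : w ≠ 0) {C : ℝ}
    {S : Set ℝ} (hS : MeasurableSet S)
    (h : ∀ x ∈ S, gaussianPDFReal m v x ≤ C * gaussianPDFReal m' w x) :
    (gaussianReal m v).real S ≤ C * (gaussianReal m' w).real S := by
  rw [gaussianReal_real_eq_setIntegral m hv, gaussianReal_real_eq_setIntegral m' hw,
    ← integral_const_mul]
  exact setIntegral_mono_on (integrable_gaussianPDFReal m v).integrableOn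
    ((integrable_gaussianPDFReal m' w).const_mul C).integrableOn hS h

/-- A Gaussian density is dominated by any Gaussian density of larger variance. -/
lemma exists_gaussianPDFReal_le_mul (m m' : ℝ) {v w : ℝ≥0} (hv : 0 < v) (hvw : v < w) :
    ∃ C : ℝ, 0 < C ∧ ∀ x, gaussianPDFReal m v x ≤ C * gaussianPDFReal m' w x := by
  have hv' : (0 : ℝ) < v := hv
  have hvw' : (v : ℝ) < w := hvw
  have hw' : (0 : ℝ) < w := hv'.trans hvw'
  have hπ := Real.pi_pos
  have hd : (0 : ℝ) < w - v := by linarith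
  -- The constant is the maximum of the density ratio; completing the square in the difference of
  -- the exponents produces it.
  refine ⟨(√(2 * Real.pi * v))⁻¹ * √(2 * Real.pi * w) *
    Real.exp ((m - m') ^ 2 / (2 * (w - v))), by positivity, fun x => ?_⟩
  have hne : √(2 * Real.pi * w) ≠ 0 := by positivity
  have hexp : -(x - m) ^ 2 / (2 * v) ≤
      (m - m') ^ 2 / (2 * (w - v)) + -(x - m') ^ 2 / (2 * w) := by
    have key : (m - m') ^ 2 / (2 * (w - v)) + -(x - m') ^ 2 / (2 * w) - -(x - m) ^ 2 / (2 * v)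
        = ((w - v) * (x - m) - v * (m - m')) ^ 2 / (2 * v * w * (w - v)) := by
      field_simp
      ring
    have : 0 ≤ ((w - v) * (x - m) - v * (m - m')) ^ 2 / (2 * v * w * (w - v)) := by positivity
    linarith
  calc gaussianPDFReal m v x = (√(2 * Real.pi * v))⁻¹ * Real.exp (-(x - m) ^ 2 / (2 * v)) := rfl
    _ ≤ (√(2 * Real.pi * v))⁻¹ *
        Real.exp ((m - m') ^ 2 / (2 * (w - v)) + -(x - m') ^ 2 / (2 * w)) := by gcongr
    _ = _ := by
      rw [Real.exp_add, gaussianPDFReal]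
      field_simp

lemma exists_gaussianReal_real_le_mul (m m' : ℝ) {v w : ℝ≥0} (hv : 0 < v) (hvw : v < w) :
    ∃ C : ℝ, 0 < C ∧ ∀ S, MeasurableSet S →
      (gaussianReal m v).real S ≤ C * (gaussianReal m' w).real S := by
  obtain ⟨C, hC, h⟩ := exists_gaussianPDFReal_le_mul m m' hv hvw
  exact ⟨C, hC, fun S hS =>
    gaussianReal_real_le_mul hv.ne' (hv.trans hvw).ne' hS fun x _ => h x⟩

/-- The signals at which the likelihood of `a` exceeds `u` times the likelihood of the other
state, when the signal has law `N(m a, v)` in state `a`. -/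
def favorRegion (m : State → ℝ) (v : ℝ≥0) (a : State) (u : ℝ) : Set ℝ :=
  {x | u * gaussianPDFReal (m !a) v x < gaussianPDFReal (m a) v x}

variable {m : State → ℝ} {v : ℝ≥0} {a : State} {u : ℝ}

lemma measurableSet_favorRegion : MeasurableSet (favorRegion m v a u) :=
  measurableSet_lt ((measurable_gaussianPDFReal _ _).const_mul u) (measurable_gaussianPDFReal _ _)

lemma favorRegion_antitone {u u' : ℝ} (h : u ≤ u') :
    favorRegion m v a u' ⊆ favorRegion m v a u := fun _ hx =>
  lt_of_le_of_lt (mul_le_mul_of_nonneg_right h (gaussianPDFReal_nonneg _ _ _)) hx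

lemma gaussianPDFReal_eq_mul_exp (hv : 0 < v) (m m' x : ℝ) :
    gaussianPDFReal m v x =
      gaussianPDFReal m' v x * Real.exp ((m - m') / v * x + (m' ^ 2 - m ^ 2) / (2 * v)) := by
  have hv' : (v : ℝ) ≠ 0 := by exact_mod_cast hv.ne'
  rw [gaussianPDFReal, gaussianPDFReal, mul_assoc (√(2 * Real.pi * v))⁻¹, ← Real.exp_add]
  congr 2
  field_simp
  ring

/-- With equal variances the quadratic terms cancel, so the log likelihood ratio is affine in the
signal. When the means differ its slope is nonzero and the region is an open half-line. -/
lemma mem_favorRegion_iff (hv : 0 < v) (hu : 0 < u) {x : ℝ} :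
    x ∈ favorRegion m v a u ↔
      Real.log u < (m a - m !a) / v * x + ((m !a) ^ 2 - (m a) ^ 2) / (2 * v) := by
  have hp := gaussianPDFReal_pos (m !a) v x hv.ne'
  rw [favorRegion, Set.mem_ofPred_eq, gaussianPDFReal_eq_mul_exp hv (m a) (m !a) x, mul_comm u,
    mul_lt_mul_iff_right₀ hp, Real.log_lt_iff_lt_exp hu]

lemma mean_ne_mean_not (hm : m true ≠ m false) (a : State) : m a ≠ m !a := by
  cases a
  · exact hm.symm
  · exact hm

lemma volume_favorRegion_pos (hm : m true ≠ m false) (hv : 0 < v) (hu : 0 < u) :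
    0 < volume (favorRegion m v a u) := by
  have hv' : (v : ℝ) ≠ 0 := by exact_mod_cast hv.ne'
  have hd : m a - (m !a) ≠ 0 := sub_ne_zero.2 (mean_ne_mean_not hm a)
  have heq : favorRegion m v a u =
      {x | Real.log u < (m a - m !a) / v * x + ((m !a) ^ 2 - (m a) ^ 2) / (2 * v)} :=
    Set.ext fun x => mem_favorRegion_iff hv hu
  rw [heq]
  refine IsOpen.measure_pos _ (isOpen_lt (by fun_prop) (by fun_prop)) ?_
  -- This is the signal at which the affine log likelihood ratio equals `log u + 1`.
  refine ⟨(Real.log u + 1 - ((m !a) ^ 2 - (m a) ^ 2) / (2 * v)) / ((m a - m !a) / v), ?_⟩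
  rw [Set.mem_ofPred_eq, mul_div_cancel₀ _ (div_ne_zero hd hv')]
  linarith

/-- Signals have unbounded strength: no finite public likelihood ratio rules out either action. The
law `gaussianReal m₁ v₁` is arbitrary so that this serves both sources. -/
lemma gaussianReal_favorRegion_pos (hm : m true ≠ m false) (hv : 0 < v) (hu : 0 < u) (m₁ : ℝ)
    {v₁ : ℝ≥0} (hv₁ : 0 < v₁) : 0 < (gaussianReal m₁ v₁).real (favorRegion m v a u) := by
  refine ENNReal.toReal_pos (fun h => ?_) (measure_ne_top _ _)
  exact (volume_favorRegion_pos hm hv hu).ne' (gaussianReal_absolutelyContinuous' m₁ hv₁.ne' h)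

/-- Up to ties, every signal favors one of the two states. -/
lemma compl_favorRegion_ae_eq (hm : m true ≠ m false) (hv : 0 < v) (hu : 0 < u) :
    ((favorRegion m v a u)ᶜ : Set ℝ) =ᵐ[volume] favorRegion m v (!a) u⁻¹ := by
  have hv' : (v : ℝ) ≠ 0 := by exact_mod_cast hv.ne'
  have hd : (m a - m !a) / v ≠ 0 := div_ne_zero (sub_ne_zero.2 (mean_ne_mean_not hm a)) hv'
  set x₀ := (Real.log u - ((m !a) ^ 2 - (m a) ^ 2) / (2 * v)) / ((m a - m !a) / v) with hx₀
  have hae : ∀ᵐ x : ℝ, x ≠ x₀ := by simp [ae_iff]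
  filter_upwards [hae] with x hx
  have hne : (m a - m !a) / v * x + ((m !a) ^ 2 - (m a) ^ 2) / (2 * v) ≠ Real.log u := by
    intro h
    apply hx
    rw [hx₀, eq_div_iff hd]
    linarith
  refine propext ?_
  change x ∉ favorRegion m v a u ↔ x ∈ favorRegion m v (!a) u⁻¹
  rw [mem_favorRegion_iff hv hu, mem_favorRegion_iff hv (inv_pos.2 hu), Bool.not_not, Real.log_inv]
  have e : (m (!a) - m a) / v * x + ((m a) ^ 2 - (m !a) ^ 2) / (2 * v) =
      -((m a - m !a) / v * x + ((m !a) ^ 2 - (m a) ^ 2) / (2 * v)) := by ring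
  rw [e, neg_lt_neg_iff, not_lt]
  exact ⟨fun h => lt_of_le_of_ne h hne, le_of_lt⟩

lemma gaussianReal_real_congr {m₁ : ℝ} {v₁ : ℝ≥0} (hv₁ : 0 < v₁) {S T : Set ℝ}
    (h : S =ᵐ[volume] T) : (gaussianReal m₁ v₁).real S = (gaussianReal m₁ v₁).real T :=
  measureReal_congr ((gaussianReal_absolutelyContinuous m₁ hv₁.ne').ae_eq h)

lemma gaussianReal_real_favorRegion_add (hm : m true ≠ m false) (hv : 0 < v) (hu : 0 < u) (m₁ : ℝ)
    {v₁ : ℝ≥0} (hv₁ : 0 < v₁) :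
    (gaussianReal m₁ v₁).real (favorRegion m v a u) +
      (gaussianReal m₁ v₁).real (favorRegion m v (!a) u⁻¹) = 1 := by
  rw [← gaussianReal_real_congr hv₁ (compl_favorRegion_ae_eq hm hv hu),
    probReal_add_probReal_compl measurableSet_favorRegion]

lemma mul_real_le_of_subset_favorRegion (hv : 0 < v) {S : Set ℝ} (hS : MeasurableSet S) (hu : 0 < u)
    (hsub : S ⊆ favorRegion m v a u) :
    u * (gaussianReal (m !a) v).real S ≤ (gaussianReal (m a) v).real S := by
  have h := gaussianReal_real_le_mul (m := m !a) (m' := m a) (C := u⁻¹) hv.ne' hv.ne' hS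
    fun x hx => by
      have hx' : u * gaussianPDFReal (m !a) v x < gaussianPDFReal (m a) v x := hsub hx
      rw [inv_mul_eq_div, le_div_iff₀ hu]
      linarith
  rwa [inv_mul_eq_div, le_div_iff₀ hu, mul_comm] at h

lemma mul_real_favorRegion_le (hv : 0 < v) (hu : 0 < u) :
    u * (gaussianReal (m !a) v).real (favorRegion m v a u) ≤
      (gaussianReal (m a) v).real (favorRegion m v a u) :=
  mul_real_le_of_subset_favorRegion hv measurableSet_favorRegion hu subset_rfl

/-- Split the region at threshold 2. Where the likelihood ratio exceeds 2, the other state has at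
most half the mass of `a`; on the remainder the ratio still exceeds `u ≥ 1`, so nothing is lost. -/
lemma real_favorRegion_add_le (hv : 0 < v) (h1 : 1 ≤ u) (h2 : u ≤ 2) :
    (gaussianReal (m !a) v).real (favorRegion m v a u) +
        (gaussianReal (m a) v).real (favorRegion m v a 2) / 2 ≤
      (gaussianReal (m a) v).real (favorRegion m v a u) := by
  have hsub : favorRegion m v a 2 ⊆ favorRegion m v a u := favorRegion_antitone h2
  have hd (m₁ : ℝ) := measureReal_sdiff_add_inter (μ := gaussianReal m₁ v)
    (s := favorRegion m v a u) (t := favorRegion m v a 2) measurableSet_favorRegion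
  simp only [Set.inter_eq_right.2 hsub] at hd
  have h3 := mul_real_favorRegion_le (m := m) (v := v) (a := a) (u := 2) hv two_pos
  have h4 := mul_real_le_of_subset_favorRegion (m := m) (a := a) (u := 1) hv
    (measurableSet_favorRegion.diff measurableSet_favorRegion) one_pos
    ((Set.sdiff_subset (s := favorRegion m v a u) (t := favorRegion m v a 2)).trans
      (favorRegion_antitone h1))
  have h5 := hd (m a)
  have h6 := hd (m !a)
  linarith

/-- Near indifference, each action is strictly more likely in the state that it matches. -/
lemma exists_real_favorRegion_add_le (hm : m true ≠ m false) (hv : 0 < v) :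
    ∃ δ : ℝ, 0 < δ ∧ ∀ (a : State) (u : ℝ), 1 / 2 ≤ u → u ≤ 2 →
      (gaussianReal (m !a) v).real (favorRegion m v a u) + δ ≤
        (gaussianReal (m a) v).real (favorRegion m v a u) := by
  have hpos (a : State) : 0 < (gaussianReal (m a) v).real (favorRegion m v a 2) :=
    gaussianReal_favorRegion_pos hm hv two_pos _ hv
  set d : State → ℝ := fun a => (gaussianReal (m a) v).real (favorRegion m v a 2) / 2 with hd
  have hmin (a : State) : min (d true) (d false) ≤ d a := by cases a <;> simp
  refine ⟨min (d true) (d false), lt_min (half_pos (hpos _)) (half_pos (hpos _)), ?_⟩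
  intro a u h1 h2
  have hu : 0 < u := by linarith
  rcases le_total 1 u with h | h
  · have := real_favorRegion_add_le (m := m) (a := a) hv h h2
    have := hmin a
    simp only [hd] at *
    linarith
  -- For `u ≤ 1`, pass to the complement, which up to ties is the region of `!a` at threshold `u⁻¹ ∈
  -- [1, 2]`.
  · have h3 := real_favorRegion_add_le (m := m) (a := !a) hv ((one_le_inv₀ hu).2 h)
      (inv_le_of_inv_le₀ two_pos (by linarith))
    have h4 := gaussianReal_real_favorRegion_add (a := a) hm hv hu (m a) hv
    have h5 := gaussianReal_real_favorRegion_add (a := a) hm hv hu (m !a) hv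
    have := hmin (!a)
    rw [Bool.not_not] at h3
    simp only [hd] at *
    linarith

/-- A set on which one weighted density strictly exceeds another, but whose weighted probability
is not larger, is null. -/
lemma volume_eq_zero_of_mul_real_le (hv : 0 < v) {m₁ m₂ α β : ℝ} {S : Set ℝ}
    (hS : MeasurableSet S)
    (hlt : ∀ x ∈ S, α * gaussianPDFReal m₁ v x < β * gaussianPDFReal m₂ v x)
    (hle : β * (gaussianReal m₂ v).real S ≤ α * (gaussianReal m₁ v).real S) : volume S = 0 := by
  have i1 := ((integrable_gaussianPDFReal m₁ v).const_mul α).integrableOn (s := S)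
  have i2 := ((integrable_gaussianPDFReal m₂ v).const_mul β).integrableOn (s := S)
  rw [gaussianReal_real_eq_setIntegral m₁ hv.ne', gaussianReal_real_eq_setIntegral m₂ hv.ne',
    ← integral_const_mul, ← integral_const_mul, ← sub_nonpos, ← integral_sub i2 i1] at hle
  by_contra hne
  refine hle.not_gt ((setIntegral_pos_iff_support_of_nonneg_ae ?_ (i2.sub i1)).2 ?_)
  · exact (ae_restrict_iff' hS).2 (Eventually.of_forall fun x hx => (sub_pos.2 (hlt x hx)).le)
  · refine (pos_iff_ne_zero.2 hne).trans_le (measure_mono fun x hx => ⟨?_, hx⟩)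
    exact (sub_pos.2 (hlt x hx)).ne'

end Gaussian

/-! ### Infinite products -/

section Products

/-- The partial products decrease to the infinite product, which is nonzero because its factors are
nonzero and their distances to 1 are summable. -/
lemma exists_le_prod_of_summable_one_sub {r : ℕ → ℝ} (h0 : ∀ k, 0 < r k) (h1 : ∀ k, r k ≤ 1)
    (hs : Summable fun k => 1 - r k) : ∃ ε : ℝ, 0 < ε ∧ ∀ t, ε ≤ ∏ k ∈ Finset.range t, r k := by
  have hs' : Summable fun k => ‖r k - 1‖ := by
    refine hs.congr fun k => ?_
    rw [Real.norm_eq_abs, abs_sub_comm, abs_of_nonneg (sub_nonneg.2 (h1 k))]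
  have hr : (fun k => 1 + (r k - 1)) = r := by funext k; ring
  have hne := tprod_one_add_ne_zero_of_summable (f := fun k => r k - 1)
    (fun k => by simpa using (h0 k).ne') hs'
  have hmul := multipliable_one_add_of_summable hs'
  rw [hr] at hne hmul
  have hanti : Antitone fun t => ∏ k ∈ Finset.range t, r k := antitone_nat_of_succ_le fun t => by
    rw [Finset.prod_range_succ]
    exact mul_le_of_le_one_right (Finset.prod_nonneg fun k _ => (h0 k).le) (h1 t)
  have hle := hanti.le_of_tendsto hmul.hasProd.tendsto_prod_nat
  refine ⟨_, lt_of_le_of_ne ?_ hne.symm, hle⟩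
  exact ge_of_tendsto' hmul.hasProd.tendsto_prod_nat
    fun t => Finset.prod_nonneg fun k _ => (h0 k).le

lemma summable_one_sub_of_le_prod {r : ℕ → ℝ} (h0 : ∀ k, 0 < r k) (h1 : ∀ k, r k ≤ 1) {ε : ℝ}
    (hε : 0 < ε) (h : ∀ t, ε ≤ ∏ k ∈ Finset.range t, r k) : Summable fun k => 1 - r k := by
  refine summable_of_sum_range_le (c := -Real.log ε) (fun k => sub_nonneg.2 (h1 k)) fun t => ?_
  have hprod : ∏ k ∈ Finset.range t, r k ≤ Real.exp (-∑ k ∈ Finset.range t, (1 - r k)) := by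
    rw [← Finset.sum_neg_distrib, Real.exp_sum]
    refine Finset.prod_le_prod (fun k _ => (h0 k).le) fun k _ => ?_
    have := Real.add_one_le_exp (-(1 - r k))
    linarith
  have := (Real.log_le_iff_le_exp hε).2 ((h t).trans hprod)
  linarith

end Products

/-! ### Likelihoods along a sequence of threshold actions -/

/-- Along the action sequence `c`, the likelihood `w a t` of the first `t` actions under an
informative source in state `a`, and their likelihood `z t` under an uninformative source, when
each agent takes the action favored by the public likelihoods and her own signal. -/
structure IsThresholdPath (m : State → ℝ) (v : ℝ≥0) (m₀ : ℝ) (v₀ : ℝ≥0) (c : ℕ → State)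
    (w : State → ℕ → ℝ) (z : ℕ → ℝ) : Prop where
  pos : ∀ a t, 0 < w a t
  zero : ∀ a, w a 0 = 1
  zero' : z 0 = 1
  succ : ∀ a t, w a (t + 1) = w a t *
    (gaussianReal (m a) v).real (favorRegion m v (c t) (w (!c t) t / w (c t) t))
  succ' : ∀ t, z (t + 1) = z t *
    (gaussianReal m₀ v₀).real (favorRegion m v (c t) (w (!c t) t / w (c t) t))

namespace IsThresholdPath

variable {m : State → ℝ} {v : ℝ≥0} {m₀ : ℝ} {v₀ : ℝ≥0} {c : ℕ → State} {w : State → ℕ → ℝ}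
  {z : ℕ → ℝ}

lemma ratio_pos (h : IsThresholdPath m v m₀ v₀ c w z) (t : ℕ) :
    0 < w (!c t) t / w (c t) t := div_pos (h.pos _ _) (h.pos _ _)

lemma eq_prod (h : IsThresholdPath m v m₀ v₀ c w z) (a : State) (t : ℕ) :
    w a t = ∏ k ∈ Finset.range t,
      (gaussianReal (m a) v).real (favorRegion m v (c k) (w (!c k) k / w (c k) k)) := by
  induction t with
  | zero => simp [h.zero]
  | succ t ih => rw [Finset.prod_range_succ, h.succ, ← ih]

lemma eq_prod' (h : IsThresholdPath m v m₀ v₀ c w z) (t : ℕ) :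
    z t = ∏ k ∈ Finset.range t,
      (gaussianReal m₀ v₀).real (favorRegion m v (c k) (w (!c k) k / w (c k) k)) := by
  induction t with
  | zero => simp [h.zero']
  | succ t ih => rw [Finset.prod_range_succ, h.succ', ← ih]

lemma le_one (h : IsThresholdPath m v m₀ v₀ c w z) (a : State) (t : ℕ) : w a t ≤ 1 := by
  rw [h.eq_prod]
  exact Finset.prod_le_one (fun _ _ => measureReal_nonneg) fun _ _ => measureReal_le_one

/-- An action reveals that the state it matches is at least as likely as the other one. -/
lemma not_le (h : IsThresholdPath m v m₀ v₀ c w z) (hv : 0 < v) (t : ℕ) :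
    w (!c t) (t + 1) ≤ w (c t) (t + 1) := by
  have h1 := mul_real_favorRegion_le (m := m) (a := c t) hv (h.ratio_pos t)
  rw [div_mul_eq_mul_div, div_le_iff₀ (h.pos _ _)] at h1
  rw [h.succ, h.succ]
  linarith

/-- If uninformative signals have the larger variance, then every infinite action sequence is
negligible under an uninformative source. -/
lemma exists_lt (h : IsThresholdPath m v m₀ v₀ c w z) (hm : m true ≠ m false) (hv : 0 < v)
    (hvv₀ : v < v₀) {ε : ℝ} (hε : 0 < ε) : ∃ t, z t < ε := by
  have hv₀ : 0 < v₀ := hv.trans hvv₀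
  by_contra! hz
  have hsum := summable_one_sub_of_le_prod
    (fun k => gaussianReal_favorRegion_pos hm hv (h.ratio_pos k) m₀ hv₀)
    (fun k => measureReal_le_one) hε fun t => (hz t).trans_eq (h.eq_prod' t)
  -- Each deviation probability under an informative law is at most `C` times the one under the
  -- uninformative law, so summability transfers and the informative likelihoods stay bounded below.
  have hw (a : State) : ∃ η : ℝ, 0 < η ∧ ∀ t, η ≤ w a t := by
    obtain ⟨C, -, hC⟩ := exists_gaussianReal_real_le_mul (m a) m₀ hv hvv₀
    simp only [h.eq_prod a]
    refine exists_le_prod_of_summable_one_sub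
      (fun k => gaussianReal_favorRegion_pos hm hv (h.ratio_pos k) (m a) hv)
      (fun k => measureReal_le_one) ?_
    refine Summable.of_nonneg_of_le (fun k => sub_nonneg.2 measureReal_le_one) (fun k => ?_)
      (hsum.mul_left C)
    rw [← probReal_compl_eq_one_sub measurableSet_favorRegion,
      ← probReal_compl_eq_one_sub measurableSet_favorRegion]
    exact hC _ measurableSet_favorRegion.compl
  choose η hη hle using hw
  set ξ : State → ℝ := fun a => (gaussianReal m₀ v₀).real (favorRegion m v (!a) (η !a)⁻¹) with hξ
  have hξ0 (a : State) : 0 < ξ a := gaussianReal_favorRegion_pos hm hv (inv_pos.2 (hη _)) m₀ hv₀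
  -- Since `w (c k) k ≤ 1`, the likelihood ratio is at least `η (!c k)`. The contrarian region thus
  -- contains a fixed one of positive probability, so deviation probabilities cannot tend to 0.
  have hbound (k : ℕ) : min (ξ true) (ξ false) ≤
      1 - (gaussianReal m₀ v₀).real (favorRegion m v (c k) (w (!c k) k / w (c k) k)) := by
    have h1 := gaussianReal_real_favorRegion_add (a := c k) hm hv (h.ratio_pos k) m₀ hv₀
    have h2 : min (ξ true) (ξ false) ≤ ξ (c k) := by cases c k <;> simp
    have h3 : η (!c k) ≤ w (!c k) k / w (c k) k :=
      (hle _ k).trans (le_div_self (h.pos _ _).le (h.pos _ _) (h.le_one _ _))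
    have h4 := measureReal_mono (μ := gaussianReal m₀ v₀) (favorRegion_antitone (m := m) (v := v)
      (a := !c k) (inv_anti₀ (hη _) h3))
    simp only [hξ] at h2
    linarith
  have := ge_of_tendsto' hsum.tendsto_atTop_zero hbound
  exact absurd (lt_min (hξ0 true) (hξ0 false)) this.not_gt

/-- If uninformative signals have the smaller variance, then immediate herding on one action has
positive probability under an informative and under an uninformative source. -/
lemma exists_le_of_const (h : IsThresholdPath m v m₀ v₀ c w z) (hm : m true ≠ m false)
    (hv₀ : 0 < v₀) (hvv₀ : v₀ < v) {a : State} (hc : ∀ t, c t = a) :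
    ∃ ε : ℝ, 0 < ε ∧ ∀ t, ε ≤ w a t ∧ ε ≤ z t := by
  have hv : 0 < v := hv₀.trans hvv₀
  set u : ℕ → ℝ := fun t => w (!a) t / w a t with hu
  set x : ℕ → ℝ := fun t => (gaussianReal (m a) v).real (favorRegion m v a (u t)) with hx
  set y : ℕ → ℝ := fun t => (gaussianReal (m !a) v).real (favorRegion m v a (u t)) with hy
  have hu0 (t : ℕ) : 0 < u t := div_pos (h.pos _ _) (h.pos _ _)
  have hx0 (t : ℕ) : 0 < x t := gaussianReal_favorRegion_pos hm hv (hu0 t) _ hv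
  have hx1 (t : ℕ) : x t ≤ 1 := measureReal_le_one
  have hsucc (t : ℕ) : u (t + 1) = u t * (y t / x t) := by
    have := (h.pos a t).ne'
    have := (hx0 t).ne'
    have e1 : w (!a) (t + 1) = w (!a) t * y t := by rw [h.succ]; simp only [hc, hy, hu]
    have e2 : w a (t + 1) = w a t * x t := by rw [h.succ]; simp only [hc, hx, hu]
    change w (!a) (t + 1) / w a (t + 1) = w (!a) t / w a t * (y t / x t)
    rw [e1, e2]
    field_simp
  -- On the deviation region the state `!a` is favored at threshold `(u t)⁻¹`; integrating the
  -- densities over it gives the bound.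
  have hratio (t : ℕ) : 1 - x t ≤ u t * (1 - y t) := by
    have h1 := mul_real_favorRegion_le (m := m) (a := !a) hv (inv_pos.2 (hu0 t))
    have h2 := gaussianReal_real_favorRegion_add (a := a) hm hv (hu0 t) (m a) hv
    have h3 := gaussianReal_real_favorRegion_add (a := a) hm hv (hu0 t) (m !a) hv
    rw [Bool.not_not, inv_mul_eq_div, div_le_iff₀ (hu0 t)] at h1
    simp only [hx, hy]
    rw [sub_eq_of_eq_add' h2.symm, sub_eq_of_eq_add' h3.symm]
    linarith
  have hu00 : u 0 = 1 := by simp [hu, h.zero]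
  obtain ⟨δ, hδ, hδle⟩ := exists_real_favorRegion_add_le hm hv
  have hyx0 : y 0 < x 0 := by
    have := hδle a (u 0) (by rw [hu00]; norm_num) (by rw [hu00]; norm_num)
    simp only [hx, hy]
    linarith
  have hu1 : u 1 < 1 := by
    rw [hsucc, hu00, one_mul]
    exact (div_lt_one (hx0 0)).2 hyx0
  have hy1 (t : ℕ) : y t ≤ 1 := measureReal_le_one
  -- By `hratio`, `x t - y t ≥ (1 - u t) * (1 - y t)`, so once `u t` is bounded away from 1 the
  -- decrease of `u` controls the deviation probability. This makes the sum telescope.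
  have hstep (t : ℕ) (ht : u t ≤ u 1) :
      u t * (1 - y t) ≤ (u t - u (t + 1)) / (1 - u 1) := by
    have hr := hratio t
    have h1 : 0 < 1 - u 1 := sub_pos.2 hu1
    have h2 : (1 - u 1) * (1 - y t) ≤ x t - y t := by nlinarith [hy1 t]
    have h3 : x t - y t ≤ (x t - y t) / x t :=
      le_div_self (by nlinarith [hy1 t]) (hx0 t) (hx1 t)
    have h4 : u t - u (t + 1) = u t * ((x t - y t) / x t) := by
      have := (hx0 t).ne'
      rw [hsucc]
      field_simp
    rw [le_div_iff₀ h1, h4]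
    nlinarith [hu0 t]
  have hle (t : ℕ) : u (t + 1) ≤ u 1 := by
    induction t with
    | zero => simp
    | succ t ih =>
      have h1 := hstep (t + 1) ih
      have h2 : 0 ≤ u (t + 1) * (1 - y (t + 1)) :=
        mul_nonneg (hu0 _).le (sub_nonneg.2 (hy1 _))
      have h3 := h2.trans h1
      rw [le_div_iff₀ (sub_pos.2 hu1)] at h3
      linarith
  have hsum : Summable fun t => 1 - x t := by
    -- The first term is dropped because `u 0 = 1`, whereas the estimate needs `u t ≤ u 1 < 1`.
    rw [← summable_nat_add_iff 1]
    refine summable_of_sum_range_le (c := u 1 / (1 - u 1)) (fun t => sub_nonneg.2 (hx1 _))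
      fun n => ?_
    calc ∑ t ∈ Finset.range n, (1 - x (t + 1))
        ≤ ∑ t ∈ Finset.range n, (u (t + 1) - u (t + 1 + 1)) / (1 - u 1) :=
          Finset.sum_le_sum fun t _ => (hratio _).trans (hstep _ (hle t))
      _ = (u 1 - u (n + 1)) / (1 - u 1) := by
          rw [← Finset.sum_div, Finset.sum_range_sub' (fun t => u (t + 1))]
      _ ≤ u 1 / (1 - u 1) := by
          have := hu0 (n + 1)
          have := sub_pos.2 hu1
          gcongr
          linarith
  obtain ⟨C, -, hC⟩ := exists_gaussianReal_real_le_mul m₀ (m a) hv₀ hvv₀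
  have hsum₀ : Summable fun t => 1 - (gaussianReal m₀ v₀).real (favorRegion m v a (u t)) := by
    refine Summable.of_nonneg_of_le (fun k => sub_nonneg.2 measureReal_le_one) (fun k => ?_)
      (hsum.mul_left C)
    simp only [hx]
    rw [← probReal_compl_eq_one_sub measurableSet_favorRegion,
      ← probReal_compl_eq_one_sub measurableSet_favorRegion]
    exact hC _ measurableSet_favorRegion.compl
  obtain ⟨ε₁, hε₁, h₁⟩ := exists_le_prod_of_summable_one_sub hx0 hx1 hsum
  obtain ⟨ε₂, hε₂, h₂⟩ := exists_le_prod_of_summable_one_sub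
    (fun k => gaussianReal_favorRegion_pos hm hv (hu0 k) _ hv₀) (fun k => measureReal_le_one) hsum₀
  refine ⟨min ε₁ ε₂, lt_min hε₁ hε₂, fun t => ⟨?_, ?_⟩⟩
  · rw [h.eq_prod]
    simp only [hc]
    exact (min_le_left _ _).trans (h₁ t)
  · rw [h.eq_prod']
    simp only [hc]
    exact (min_le_right _ _).trans (h₂ t)

/-- If the public belief about the state converges, then so do the actions. -/
lemma exists_eventually_eq (h : IsThresholdPath m v m₀ v₀ c w z) (hm : m true ≠ m false)
    (hv : 0 < v) {ℓ : ℝ}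
    (hℓ : Tendsto (fun t => w false t / (w true t + w false t)) atTop (𝓝 ℓ)) :
    ∃ a, ∀ᶠ t in atTop, c t = a := by
  by_contra! hne
  have hfreq (a : State) : ∃ᶠ t in atTop, c t = a := by
    refine (hne !a).mono fun t ht => ?_
    simpa using ht
  have hfreq' (a : State) : ∃ᶠ t in atTop, w (!a) t ≤ w a t := by
    -- The inequality holds just after the action `a` is taken, hence the shift by one.
    refine (tendsto_add_atTop_nat 1).frequently ((hfreq a).mono fun t ht => ?_)
    have := h.not_le hv t
    rwa [ht] at this
  have hT := h.pos true
  have hF := h.pos false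
  have h1 : ℓ ≤ 1 / 2 := by
    refine le_of_tendsto_of_frequently hℓ ((hfreq' true).mono fun t ht => ?_)
    have := hT t
    have := hF t
    rw [Bool.not_true] at ht
    rw [div_le_div_iff₀ (by positivity) two_pos]
    linarith
  have h2 : 1 / 2 ≤ ℓ := by
    refine ge_of_tendsto_of_frequently hℓ ((hfreq' false).mono fun t ht => ?_)
    have := hT t
    have := hF t
    rw [Bool.not_false] at ht
    rw [div_le_div_iff₀ two_pos (by positivity)]
    linarith
  obtain rfl : ℓ = 1 / 2 := le_antisymm h1 h2
  have hu : Tendsto (fun t => w false t / w true t) atTop (𝓝 1) := by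
    have hlim := hℓ.div (hℓ.const_sub 1) (by norm_num)
    norm_num at hlim
    refine hlim.congr fun t => ?_
    have := hT t
    have := hF t
    have hsub : 1 - w false t / (w true t + w false t) = w true t / (w true t + w false t) := by
      field_simp
      ring
    rw [Pi.div_apply, hsub]
    field_simp
  obtain ⟨δ, hδ, hδle⟩ := exists_real_favorRegion_add_le hm hv
  -- A ratio converging to 1 eventually shrinks by less than the factor `1 - δ` per step. Taking the
  -- action `true` near indifference shrinks it by at least that factor, since `y + δ ≤ x ≤ 1` gives
  -- `y / x ≤ 1 - δ`.
  have hlt := (hu.const_mul (1 - δ)).eventually_lt (hu.comp (tendsto_add_atTop_nat 1))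
    (by linarith)
  have hnear := hu.eventually (Icc_mem_nhds (a := 1 / 2) (b := 2) (by norm_num) (by norm_num))
  obtain ⟨t, ⟨ht, hlt⟩, hge, hle⟩ := (((hfreq true).and_eventually hlt).and_eventually hnear).exists
  refine hlt.not_ge ?_
  have hd := hδle true _ hge hle
  set x := (gaussianReal (m true) v).real (favorRegion m v true (w false t / w true t)) with hx
  have hx0 : 0 < x := gaussianReal_favorRegion_pos hm hv (div_pos (hF t) (hT t)) _ hv
  have hx1 : x ≤ 1 := measureReal_le_one
  have e1 := h.succ true t
  have e2 := h.succ false t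
  simp only [ht, Bool.not_true, ← hx] at e1 e2 hd
  change w false (t + 1) / w true (t + 1) ≤ (1 - δ) * (w false t / w true t)
  rw [e1, e2, mul_div_mul_comm, mul_comm]
  refine mul_le_mul_of_nonneg_right ?_ (div_pos (hF t) (hT t)).le
  rw [div_le_iff₀ hx0]
  nlinarith

end IsThresholdPath

/-! ### Histories and action sequences -/

section History

variable {Ω S : Type*} [MeasurableSpace S]

/-- The first `t` actions of an infinite action sequence. -/
def initialActions (c : ℕ → State) (t : ℕ) : Fin t → State := fun k => c k

/-- The signals at which agent `t` takes the action `a` after the history given by `c`. -/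
def choiceSet (f : StrategyProfile S) (c : ℕ → State) (t : ℕ) (a : State) : Set S :=
  {y | f.choose t (initialActions c t, y) = a}

lemma measurableSet_choiceSet (f : StrategyProfile S) (c : ℕ → State) (t : ℕ) (a : State) :
    MeasurableSet (choiceSet f c t a) :=
  ((f.measurable_choose t).comp measurable_prodMk_left) (measurableSet_singleton a)

lemma history_eq_initialActions (f : StrategyProfile S) (s : ℕ → S) (t : ℕ) :
    history f s t = initialActions (action f s) t := by
  induction t with
  | zero => exact Subsingleton.elim _ _
  | succ t ih =>
    funext k
    refine Fin.lastCases ?_ (fun k => ?_) k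
    · simp [history, initialActions, action]
    · simp only [history, Fin.snoc_castSucc, ih]
      rfl

lemma initialActions_eq_iff {c c' : ℕ → State} {t : ℕ} :
    initialActions c t = initialActions c' t ↔ ∀ k < t, c k = c' k :=
  ⟨fun h k hk => congrFun h ⟨k, hk⟩, fun h => funext fun k => h k k.2⟩

/-- Although actions depend on earlier ones, on this event the past is pinned to `c`. The event thus
becomes a conjunction of conditions on single signals, which is what lets independence factor its
probability. -/
lemma history_eq_iff (f : StrategyProfile S) (s : ℕ → S) (c : ℕ → State) (t : ℕ) :
    history f s t = initialActions c t ↔ ∀ k < t, s k ∈ choiceSet f c k (c k) := by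
  have hiff (k : ℕ) (hk : ∀ j < k, action f s j = c j) :
      action f s k = c k ↔ s k ∈ choiceSet f c k (c k) := by
    rw [choiceSet, Set.mem_ofPred_eq, action, history_eq_initialActions,
      initialActions_eq_iff.2 hk]
  rw [history_eq_initialActions, initialActions_eq_iff]
  refine ⟨fun h k hk => (hiff k fun j hj => h j (hj.trans hk)).1 (h k hk), fun h k => ?_⟩
  induction k using Nat.strong_induction_on with
  | _ k ih => exact fun hk => (hiff k fun j hj => ih j hj (hj.trans hk)).2 (h k hk)

/-- The event that the first `t` actions are those of `c`. -/
def historyEvent (f : StrategyProfile S) (s : ℕ → Ω → S) (c : ℕ → State) (t : ℕ) : Set Ω :=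
  (fun x => history f (fun k => s k x) t) ⁻¹' {initialActions c t}

lemma historyEvent_eq (f : StrategyProfile S) (s : ℕ → Ω → S) (c : ℕ → State) (t : ℕ) :
    historyEvent f s c t = ⋂ k ∈ Finset.range t, s k ⁻¹' choiceSet f c k (c k) := by
  ext x
  simp [historyEvent, history_eq_iff]

lemma mem_historyEvent_iff (f : StrategyProfile S) (s : ℕ → Ω → S) (c : ℕ → State) (t : ℕ)
    (x : Ω) : x ∈ historyEvent f s c t ↔ ∀ k < t, action f (fun k => s k x) k = c k := by
  rw [historyEvent, Set.mem_preimage, history_eq_initialActions, Set.mem_singleton_iff,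
    initialActions_eq_iff]

lemma historyEvent_antitone (f : StrategyProfile S) (s : ℕ → Ω → S) (c : ℕ → State) :
    Antitone (historyEvent f s c) := fun t t' h x hx => by
  rw [mem_historyEvent_iff] at *
  exact fun k hk => hx k (hk.trans_le h)

lemma measurable_history [MeasurableSpace Ω] (f : StrategyProfile S) {s : ℕ → Ω → S} (hs : ∀ t, Measurable (s t))
    (t : ℕ) : Measurable fun x => history f (fun k => s k x) t := by
  induction t with
  | zero => exact measurable_const
  | succ t ih =>
    refine measurable_pi_lambda _ fun k => ?_
    refine Fin.lastCases ?_ (fun k => ?_) k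
    · simp only [history, Fin.snoc_last]
      exact (f.measurable_choose t).comp (ih.prodMk (hs t))
    · simp only [history, Fin.snoc_castSucc]
      exact (measurable_pi_apply k).comp ih

lemma measurableSet_historyEvent [MeasurableSpace Ω] (f : StrategyProfile S)
    {s : ℕ → Ω → S} (hs : ∀ t, Measurable (s t)) (c : ℕ → State) (t : ℕ) :
    MeasurableSet (historyEvent f s c t) :=
  measurable_history f hs t (measurableSet_singleton _)

/-- The observer's information over time. -/
def publicFiltration [MeasurableSpace Ω] (f : StrategyProfile S) {s : ℕ → Ω → S}
    (hs : ∀ t, Measurable (s t)) :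
    Filtration ℕ (inferInstance : MeasurableSpace Ω) where
  seq := publicInfo f s
  mono' := monotone_nat_of_le_succ fun t => by
    have hinit : (fun x => history f (fun k => s k x) t) =
        (fun h : Fin (t + 1) → State => Fin.init (α := fun _ => State) h) ∘
          fun x => history f (fun k => s k x) (t + 1) := by
      funext x
      simp [history]
    rw [publicInfo, hinit, ← MeasurableSpace.comap_comp]
    exact MeasurableSpace.comap_mono (Measurable.of_discrete).comap_le
  le' t := (measurable_history f hs t).comap_le

lemma measurableSet_action_eq (f : StrategyProfile S) (s : ℕ → Ω → S) (t : ℕ) (a : State) :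
    MeasurableSet[publicInfo f s (t + 1)] {x | action f (fun k => s k x) t = a} := by
  refine ⟨{h | h (Fin.last t) = a}, MeasurableSet.of_discrete, ?_⟩
  ext x
  simp [history_eq_initialActions, initialActions]

/-- The event that the actions converge. -/
def convergenceEvent (f : StrategyProfile S) (s : ℕ → Ω → S) : Set Ω :=
  {x | ∃ a, ∀ᶠ t in atTop, action f (fun k => s k x) t = a}

lemma measurableSet_convergenceEvent [MeasurableSpace Ω] (f : StrategyProfile S)
    {s : ℕ → Ω → S} (hs : ∀ t, Measurable (s t)) :
    MeasurableSet[⨆ t, publicFiltration f hs t] (convergenceEvent f s) := by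
  have heq : convergenceEvent f s =
      ⋃ a, ⋃ T, ⋂ t, ⋂ _ : T ≤ t, {x | action f (fun k => s k x) t = a} := by
    ext x
    simp [convergenceEvent, eventually_atTop]
  rw [heq]
  refine MeasurableSet.iUnion fun a => MeasurableSet.iUnion fun T =>
    MeasurableSet.iInter fun t => MeasurableSet.iInter fun _ => ?_
  exact (le_iSup (fun t => (publicFiltration f hs t : MeasurableSpace Ω)) (t + 1)) _
    (measurableSet_action_eq f s t a)

/-- Convergent action sequences form a countable family. -/
lemma convergenceEvent_subset (f : StrategyProfile S) (s : ℕ → Ω → S) :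
    convergenceEvent f s ⊆ ⋃ i : State × (Σ T, Fin T → State),
      ⋂ t, historyEvent f s (fun k => if h : k < i.2.1 then i.2.2 ⟨k, h⟩ else i.1) t := by
  rintro x ⟨a, ha⟩
  obtain ⟨T, hT⟩ := eventually_atTop.1 ha
  refine Set.mem_iUnion.2 ⟨(a, ⟨T, fun k => action f (fun k => s k x) k⟩), ?_⟩
  refine Set.mem_iInter.2 fun t => ?_
  rw [mem_historyEvent_iff]
  intro k _
  by_cases hk : k < T
  · simp [hk]
  · simp [hk, hT k (not_lt.1 hk)]

end History

/-! ### Conditional expectations given a discrete variable -/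

lemma setIntegral_indicator_one {Ω : Type*} [MeasurableSpace Ω] {μ : Measure Ω} {B E : Set Ω}
    (hB : MeasurableSet B) : ∫ x in E, B.indicator (fun _ => (1 : ℝ)) x ∂μ = μ.real (B ∩ E) := by
  rw [integral_indicator hB, Measure.restrict_restrict hB, setIntegral_const, smul_eq_mul, mul_one]

lemma integrable_indicator_one {Ω : Type*} [MeasurableSpace Ω] {μ : Measure Ω}
    [IsFiniteMeasure μ] {B : Set Ω} (hB : MeasurableSet B) :
    Integrable (B.indicator fun _ => (1 : ℝ)) μ :=
  (integrable_const 1).indicator hB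

/-- The conditional expectation is measurable for the σ-algebra of `H`, hence constant on the fibers
of `H`. Bayes' formula therefore holds at every point of a fiber of positive mass, not merely almost
everywhere. -/
lemma condExp_indicator_comap_apply {Ω α : Type*} [MeasurableSpace Ω] [MeasurableSpace α]
    [MeasurableSingletonClass α] {μ : Measure Ω} [IsFiniteMeasure μ] {H : Ω → α}
    (hH : Measurable H) {B : Set Ω} (hB : MeasurableSet B) {x : Ω}
    (hx : μ.real (H ⁻¹' {H x}) ≠ 0) :
    (μ[B.indicator (fun _ => (1 : ℝ)) | MeasurableSpace.comap H inferInstance]) x =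
      μ.real (B ∩ H ⁻¹' {H x}) / μ.real (H ⁻¹' {H x}) := by
  set g := μ[B.indicator (fun _ => (1 : ℝ)) | MeasurableSpace.comap H inferInstance] with hg
  have hfac : Function.FactorsThrough g H :=
    StronglyMeasurable.factorsThrough (stronglyMeasurable_condExp)
  have hE : MeasurableSet[MeasurableSpace.comap H inferInstance] (H ⁻¹' {H x}) :=
    ⟨_, measurableSet_singleton _, rfl⟩
  have h1 : ∫ y in H ⁻¹' {H x}, g y ∂μ = μ.real (B ∩ H ⁻¹' {H x}) := by
    rw [hg, setIntegral_condExp hH.comap_le (integrable_indicator_one hB) hE,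
      setIntegral_indicator_one hB]
  have h2 : ∫ y in H ⁻¹' {H x}, g y ∂μ = ∫ _ in H ⁻¹' {H x}, g x ∂μ :=
    setIntegral_congr_fun (hH (measurableSet_singleton _)) fun y hy => hfac hy
  rw [h2, setIntegral_const, smul_eq_mul] at h1
  rw [eq_div_iff hx, mul_comm, h1]

/-! ### Probabilities of histories -/

section Model

variable {Ω S : Type*} [MeasurableSpace Ω] [MeasurableSpace S] {P : Measure Ω}
  {γ : ℝ} {μg μb μ0 : Measure S} {θ : Ω → State} {ω : Ω → Source} {s : ℕ → Ω → S}

/-- The likelihood of the first `t` actions of `c` when signals are i.i.d. with law `ν`. -/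
def actionLikelihood (ν : Measure S) (f : StrategyProfile S) (c : ℕ → State) (t : ℕ) : ℝ :=
  ∏ k ∈ Finset.range t, ν.real (choiceSet f c k (c k))

instance isProbabilityMeasure_signalLaw [IsProbabilityMeasure μg] [IsProbabilityMeasure μb]
    [IsProbabilityMeasure μ0] (i : Source) (a : State) :
    IsProbabilityMeasure (signalLaw μg μb μ0 i a) := by
  cases i <;> cases a <;> assumption

/-- The prior probability of a state of the source. -/
def sourcePrior (γ : ℝ) : Source → ℝ
  | true => γ
  | false => 1 - γ

namespace IsModel

lemma measurableSet_source_state (h : IsModel P γ μg μb μ0 θ ω s) (i : Source) (a : State) :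
    MeasurableSet {x | ω x = i ∧ θ x = a} :=
  (h.measurable_source (measurableSet_singleton i)).inter
    (h.measurable_state (measurableSet_singleton a))

lemma measurableSet_source (h : IsModel P γ μg μb μ0 θ ω s) (i : Source) :
    MeasurableSet {x | ω x = i} := h.measurable_source (measurableSet_singleton i)

lemma measurableSet_state (h : IsModel P γ μg μb μ0 θ ω s) (a : State) :
    MeasurableSet {x | θ x = a} := h.measurable_state (measurableSet_singleton a)

lemma real_source [IsProbabilityMeasure P] (h : IsModel P γ μg μb μ0 θ ω s) (hγ : 0 ≤ γ)
    (i : Source) : P.real {x | ω x = i} = sourcePrior γ i := by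
  have htrue : P.real {x | ω x = true} = γ := by
    rw [measureReal_def, h.prior_source, ENNReal.toReal_ofReal hγ]
  cases i
  · have hc : {x | ω x = false} = {x | ω x = true}ᶜ := by ext x; simp
    rw [hc, probReal_compl_eq_one_sub (h.measurableSet_source true), htrue, sourcePrior]
  · exact htrue

lemma real_source_state [IsProbabilityMeasure P] (h : IsModel P γ μg μb μ0 θ ω s) (hγ : 0 ≤ γ)
    (i : Source) (a : State) : P.real {x | ω x = i ∧ θ x = a} = sourcePrior γ i / 2 := by
  have hind := h.indep.measure_inter_preimage_eq_mul {a} {i} (measurableSet_singleton a)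
    (measurableSet_singleton i)
  have e : {x | ω x = i ∧ θ x = a} = θ ⁻¹' {a} ∩ ω ⁻¹' {i} := by
    ext x; simp [and_comm]
  have e1 : P (θ ⁻¹' {a}) = 1 / 2 := h.prior_state a
  have e2 : (P (ω ⁻¹' {i})).toReal = sourcePrior γ i := h.real_source hγ i
  rw [e, measureReal_def, hind, ENNReal.toReal_mul, e1, e2]
  simp
  ring

lemma real_cond_historyEvent_inter (h : IsModel P γ μg μb μ0 θ ω s) (f : StrategyProfile S)
    (i : Source) (a : State) (c : ℕ → State) (t : ℕ) {B : Set S} (hB : MeasurableSet B) :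
    (P[|{x | ω x = i ∧ θ x = a}]).real (historyEvent f s c t ∩ s t ⁻¹' B) =
      actionLikelihood (signalLaw μg μb μ0 i a) f c t * (signalLaw μg μb μ0 i a).real B := by
  -- The condition on the signal of agent `t` becomes one more factor after those of her `t`
  -- predecessors.
  set D : ℕ → Set S := fun k => if k = t then B else choiceSet f c k (c k) with hD
  have hDm (k : ℕ) : MeasurableSet (D k) := by
    simp only [hD]
    split_ifs
    · exact hB
    · exact measurableSet_choiceSet f c k _
  have hlt {k : ℕ} (hk : k ∈ Finset.range t) : D k = choiceSet f c k (c k) :=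
    if_neg (Finset.mem_range.1 hk).ne
  have hset : historyEvent f s c t ∩ s t ⁻¹' B = ⋂ k ∈ Finset.range (t + 1), s k ⁻¹' D k := by
    rw [historyEvent_eq, Finset.range_add_one, Finset.set_biInter_insert, Set.inter_comm,
      show D t = B from if_pos rfl]
    congr 1
    exact Set.iInter₂_congr fun k hk => by rw [hlt hk]
  have hlaw (k : ℕ) : (P[|{x | ω x = i ∧ θ x = a}]) (s k ⁻¹' D k) =
      signalLaw μg μb μ0 i a (D k) := by
    rw [← h.signal_law i a k, Measure.map_apply (h.measurable_signal k) (hDm k)]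
  rw [measureReal_def, hset, (iIndepFun_iff_measure_inter_preimage_eq_mul.1
    (h.signal_indep i a)) _ fun k _ => hDm k, ENNReal.toReal_prod, Finset.prod_range_succ,
    actionLikelihood]
  congr 1
  · exact Finset.prod_congr rfl fun k hk => by rw [hlaw, hlt hk, measureReal_def]
  · rw [hlaw, show D t = B from if_pos rfl, measureReal_def]

lemma real_source_state_inter [IsProbabilityMeasure P] (h : IsModel P γ μg μb μ0 θ ω s)
    (hγ : 0 ≤ γ) (i : Source) (a : State) (E : Set Ω) :
    P.real ({x | ω x = i ∧ θ x = a} ∩ E) =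
      sourcePrior γ i / 2 * (P[|{x | ω x = i ∧ θ x = a}]).real E := by
  rw [← h.real_source_state hγ i a, measureReal_def, measureReal_def, measureReal_def,
    ← cond_mul_eq_inter (h.measurableSet_source_state i a), ENNReal.toReal_mul, mul_comm]

lemma real_state_inter [IsProbabilityMeasure P] (h : IsModel P γ μg μb μ0 θ ω s)
    (a : State) (E : Set Ω) :
    P.real ({x | θ x = a} ∩ E) = P.real ({x | ω x = true ∧ θ x = a} ∩ E) +
      P.real ({x | ω x = false ∧ θ x = a} ∩ E) := by
  have := measureReal_inter_add_sdiff (μ := P) (s := {x | θ x = a} ∩ E)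
    (h.measurableSet_source true)
  rw [← this]
  congr 2
  · ext x; simp; tauto
  · ext x; simp; tauto

lemma real_source_inter [IsProbabilityMeasure P] (h : IsModel P γ μg μb μ0 θ ω s)
    (i : Source) (E : Set Ω) :
    P.real ({x | ω x = i} ∩ E) = P.real ({x | ω x = i ∧ θ x = true} ∩ E) +
      P.real ({x | ω x = i ∧ θ x = false} ∩ E) := by
  have := measureReal_inter_add_sdiff (μ := P) (s := {x | ω x = i} ∩ E)
    (h.measurableSet_state true)
  rw [← this]
  congr 2
  · ext x; simp; tauto
  · ext x; simp; tauto

lemma real_source_state_historyEvent [IsProbabilityMeasure P] (h : IsModel P γ μg μb μ0 θ ω s)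
    (hγ : 0 ≤ γ) (f : StrategyProfile S) (i : Source) (a : State) (c : ℕ → State) (t : ℕ)
    [IsProbabilityMeasure (signalLaw μg μb μ0 i a)] :
    P.real ({x | ω x = i ∧ θ x = a} ∩ historyEvent f s c t) =
      sourcePrior γ i / 2 * actionLikelihood (signalLaw μg μb μ0 i a) f c t := by
  have := h.real_cond_historyEvent_inter f i a c t MeasurableSet.univ
  rw [Set.preimage_univ, Set.inter_univ, probReal_univ, mul_one] at this
  rw [h.real_source_state_inter hγ, this]

/-- Optimality of the action `a` on an event observed by the agent. -/
lemma real_state_inter_le_of_isEquilibrium [IsProbabilityMeasure P]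
    (h : IsModel P γ μg μb μ0 θ ω s) {f : StrategyProfile S} (hf : IsEquilibrium P θ s f)
    {t : ℕ} {a : State} {E : Set Ω} (hE : MeasurableSet[agentInfo f s t] E)
    (hEa : ∀ x ∈ E, action f (fun k => s k x) t = a) (b : State) :
    P.real ({x | θ x = b} ∩ E) ≤ P.real ({x | θ x = a} ∩ E) := by
  have hle : agentInfo f s t ≤ (inferInstance : MeasurableSpace Ω) :=
    ((measurable_history f h.measurable_signal t).prodMk (h.measurable_signal t)).comap_le
  have hint (b : State) :
      ∫ x in E, expectedPayoff P θ s f t b x ∂P = P.real ({x | θ x = b} ∩ E) := by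
    rw [expectedPayoff, setIntegral_condExp hle
      (integrable_indicator_one (h.measurableSet_state b)) hE,
      setIntegral_indicator_one (h.measurableSet_state b)]
  rw [← hint, ← hint]
  refine setIntegral_mono_on_ae integrable_condExp.integrableOn integrable_condExp.integrableOn
    (hle _ hE) ?_
  filter_upwards [hf t] with x hx hxE
  have := hx b
  rwa [hEa x hxE] at this

end IsModel

end Model

/-! ### Equilibrium behavior with Gaussian signals -/

section GaussianModel

variable {Ω : Type*} [MeasurableSpace Ω] {P : Measure Ω} [IsProbabilityMeasure P] {γ : ℝ}
  {m : State → ℝ} {v : ℝ≥0} {m₀ : ℝ} {v₀ : ℝ≥0} {θ : Ω → State} {ω : Ω → Source}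
  {s : ℕ → Ω → ℝ} {f : StrategyProfile ℝ}

lemma signalLaw_informative (ν : Measure ℝ) (a : State) :
    signalLaw (gaussianReal (m true) v) (gaussianReal (m false) v) ν true a =
      gaussianReal (m a) v := by
  cases a <;> rfl

lemma signalLaw_uninformative (ν₁ ν₂ ν : Measure ℝ) (a : State) :
    signalLaw ν₁ ν₂ ν false a = ν := rfl

lemma actionLikelihood_succ (ν : Measure ℝ) (f : StrategyProfile ℝ) (c : ℕ → State) (t : ℕ) :
    actionLikelihood ν f c (t + 1) =
      actionLikelihood ν f c t * ν.real (choiceSet f c t (c t)) :=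
  Finset.prod_range_succ _ _

namespace IsModel

/-- In equilibrium, an action is almost never taken when the other one is strictly better. The
uninformative source contributes equally to the payoffs of both actions. -/
lemma volume_choiceSet_inter_eq_zero
    (h : IsModel P γ (gaussianReal (m true) v) (gaussianReal (m false) v) (gaussianReal m₀ v₀)
      θ ω s) (hf : IsEquilibrium P θ s f) (hγ : 0 < γ) (hv : 0 < v) (c : ℕ → State) (t : ℕ)
    (a : State) (hpos : 0 < actionLikelihood (gaussianReal (m !a) v) f c t) :
    volume (choiceSet f c t a ∩ favorRegion m v (!a)
      (actionLikelihood (gaussianReal (m a) v) f c t /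
        actionLikelihood (gaussianReal (m !a) v) f c t)) = 0 := by
  set w : State → ℝ := fun a => actionLikelihood (gaussianReal (m a) v) f c t with hw
  set B := choiceSet f c t a ∩ favorRegion m v (!a) (w a / w !a) with hB
  have hBm : MeasurableSet B := (measurableSet_choiceSet f c t a).inter measurableSet_favorRegion
  set E := historyEvent f s c t ∩ s t ⁻¹' B with hE
  have hEm : MeasurableSet[agentInfo f s t] E := by
    refine ⟨{initialActions c t} ×ˢ B, (measurableSet_singleton _).prod hBm, ?_⟩
    ext x
    simp [hE, historyEvent]
  have hEa (x : Ω) (hx : x ∈ E) : action f (fun k => s k x) t = a := by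
    have h1 : history f (fun k => s k x) t = initialActions c t := hx.1
    have h2 : f.choose t (initialActions c t, s t x) = a := hx.2.1
    rw [action, h1, h2]
  have hle := h.real_state_inter_le_of_isEquilibrium hf hEm hEa (!a)
  simp only [h.real_state_inter, h.real_source_state_inter hγ.le, hE,
    h.real_cond_historyEvent_inter f _ _ c t hBm, signalLaw_informative,
    signalLaw_uninformative, sourcePrior] at hle
  -- The uninformative terms on the two sides of `hle` coincide and cancel, as does the common
  -- factor `γ / 2`.
  refine volume_eq_zero_of_mul_real_le (m₁ := m a) (m₂ := m !a) (α := w a) (β := w !a) hv hBm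
    (fun x hx => ?_) (le_of_mul_le_mul_left (add_le_add_iff_right _ |>.1 hle) (half_pos hγ))
  have hx2 : w a / w (!a) * gaussianPDFReal (m !!a) v x < gaussianPDFReal (m !a) v x := hx.2
  rw [Bool.not_not, div_mul_eq_mul_div, div_lt_iff₀ hpos] at hx2
  linarith

/-- Neither action is taken where the other is strictly better, and ties are null, so the
tie-breaking rule is irrelevant. Equality up to Lebesgue null sets makes the result usable under the
signal laws of both sources. -/
lemma choiceSet_ae_eq
    (h : IsModel P γ (gaussianReal (m true) v) (gaussianReal (m false) v) (gaussianReal m₀ v₀)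
      θ ω s) (hf : IsEquilibrium P θ s f) (hγ : 0 < γ) (hm : m true ≠ m false) (hv : 0 < v)
    (c : ℕ → State) (t : ℕ) (hpos : ∀ a, 0 < actionLikelihood (gaussianReal (m a) v) f c t)
    (a : State) :
    choiceSet f c t a =ᵐ[volume] favorRegion m v a
      (actionLikelihood (gaussianReal (m !a) v) f c t /
        actionLikelihood (gaussianReal (m a) v) f c t) := by
  have h1 := measure_eq_zero_iff_ae_notMem.1
    (h.volume_choiceSet_inter_eq_zero hf hγ hv c t a (hpos _))
  have h2 := measure_eq_zero_iff_ae_notMem.1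
    (h.volume_choiceSet_inter_eq_zero hf hγ hv c t (!a) (hpos _))
  have h3 := compl_favorRegion_ae_eq (a := a) hm hv (div_pos (hpos !a) (hpos a))
  rw [inv_div] at h3
  rw [Bool.not_not] at h2
  filter_upwards [h1, h2, h3.mem_iff] with x hx1 hx2 hx3
  refine propext ⟨fun hx => ?_, fun hx => ?_⟩
  · by_contra hn
    exact hx1 ⟨hx, hx3.1 hn⟩
  · by_contra hn
    refine hx2 ⟨?_, hx⟩
    change f.choose t (initialActions c t, x) = !a
    have hn' : f.choose t (initialActions c t, x) ≠ a := hn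
    exact Bool.eq_not.2 hn'

/-- In equilibrium, actions follow the threshold rule along every sequence of actions. -/
lemma isThresholdPath
    (h : IsModel P γ (gaussianReal (m true) v) (gaussianReal (m false) v) (gaussianReal m₀ v₀)
      θ ω s) (hf : IsEquilibrium P θ s f) (hγ : 0 < γ) (hm : m true ≠ m false) (hv : 0 < v)
    (hv₀ : 0 < v₀) (c : ℕ → State) :
    IsThresholdPath m v m₀ v₀ c (fun a => actionLikelihood (gaussianReal (m a) v) f c)
      (actionLikelihood (gaussianReal m₀ v₀) f c) := by
  -- Positivity must be proved along with the threshold rule: the rule at `t` needs positive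
  -- likelihoods, and gives positive ones at `t + 1`.
  have hpos (t : ℕ) : ∀ a, 0 < actionLikelihood (gaussianReal (m a) v) f c t := by
    induction t with
    | zero => simp [actionLikelihood]
    | succ t ih =>
      intro a
      rw [actionLikelihood_succ,
        gaussianReal_real_congr hv (h.choiceSet_ae_eq hf hγ hm hv c t ih (c t))]
      exact mul_pos (ih a) (gaussianReal_favorRegion_pos hm hv (div_pos (ih _) (ih _)) _ hv)
  have hae (t : ℕ) := h.choiceSet_ae_eq hf hγ hm hv c t (hpos t) (c t)
  exact
    { pos := fun a t => hpos t a
      zero := fun a => by simp [actionLikelihood]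
      zero' := by simp [actionLikelihood]
      succ := fun a t => by rw [actionLikelihood_succ, gaussianReal_real_congr hv (hae t)]
      succ' := fun t => by rw [actionLikelihood_succ, gaussianReal_real_congr hv₀ (hae t)] }

/-- If uninformative signals have the larger variance, then actions almost surely do not converge
under an uninformative source. -/
lemma measure_uninformative_inter_convergenceEvent
    (h : IsModel P γ (gaussianReal (m true) v) (gaussianReal (m false) v) (gaussianReal m₀ v₀)
      θ ω s) (hf : IsEquilibrium P θ s f) (hγ : γ ∈ Set.Ioo (0 : ℝ) 1) (hm : m true ≠ m false)
    (hv : 0 < v) (hvv₀ : v < v₀) : P ({x | ω x = false} ∩ convergenceEvent f s) = 0 := by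
  have hseq (c : ℕ → State) : P ({x | ω x = false} ∩ ⋂ t, historyEvent f s c t) = 0 := by
    rw [← measureReal_eq_zero_iff]
    refine le_antisymm (le_of_forall_pos_lt_add fun ε hε => ?_) measureReal_nonneg
    obtain ⟨t, ht⟩ := (h.isThresholdPath hf hγ.1 hm hv (hv.trans hvv₀) c).exists_lt hm hv hvv₀ hε
    have hle : P.real ({x | ω x = false} ∩ ⋂ t, historyEvent f s c t) ≤
        P.real ({x | ω x = false} ∩ historyEvent f s c t) :=
      measureReal_mono (Set.inter_subset_inter_right _ (Set.iInter_subset _ t))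
    rw [h.real_source_inter false (historyEvent f s c t),
      h.real_source_state_historyEvent hγ.1.le, h.real_source_state_historyEvent hγ.1.le,
      signalLaw_uninformative, signalLaw_uninformative, sourcePrior] at hle
    nlinarith [hγ.1, hγ.2]
  refine measure_mono_null (Set.inter_subset_inter_right _ (convergenceEvent_subset f s)) ?_
  rw [Set.inter_iUnion]
  exact measure_iUnion_null fun i => hseq _

/-- Actions almost surely converge under an informative source. -/
lemma measure_informative_diff_convergenceEvent
    (h : IsModel P γ (gaussianReal (m true) v) (gaussianReal (m false) v) (gaussianReal m₀ v₀)
      θ ω s) (hf : IsEquilibrium P θ s f) (hγ : 0 < γ) (hm : m true ≠ m false)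
    (hv : 0 < v) (hv₀ : 0 < v₀) : P ({x | ω x = true} \ convergenceEvent f s) = 0 := by
  have hsrc : P.real {x | ω x = true} = γ := h.real_source hγ.le true
  have hne : P {x | ω x = true} ≠ 0 := fun h0 => by
    rw [measureReal_def, h0, ENNReal.toReal_zero] at hsrc
    exact hγ.ne hsrc
  have hprob : IsProbabilityMeasure (P[|{x | ω x = true}]) := cond_isProbabilityMeasure hne
  have hcond (E : Set Ω) :
      (P[|{x | ω x = true}]).real E = γ⁻¹ * P.real ({x | ω x = true} ∩ E) := by
    rw [measureReal_def, cond_apply (h.measurableSet_source true), ENNReal.toReal_mul,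
      ENNReal.toReal_inv, ← measureReal_def, ← measureReal_def, hsrc]
  have hstate (a : State) (c : ℕ → State) (t : ℕ) :
      (P[|{x | ω x = true}]).real ({x | θ x = a} ∩ historyEvent f s c t) =
        1 / 2 * actionLikelihood (gaussianReal (m a) v) f c t := by
    have e : {x | ω x = true} ∩ ({x | θ x = a} ∩ historyEvent f s c t) =
        {x | ω x = true ∧ θ x = a} ∩ historyEvent f s c t := by
      rw [← Set.inter_assoc]; rfl
    rw [hcond, e, h.real_source_state_historyEvent hγ.le, signalLaw_informative, sourcePrior]
    field_simp
  have htotal (c : ℕ → State) (t : ℕ) : (P[|{x | ω x = true}]).real (historyEvent f s c t) =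
      1 / 2 * (actionLikelihood (gaussianReal (m true) v) f c t +
        actionLikelihood (gaussianReal (m false) v) f c t) := by
    rw [hcond, h.real_source_inter, h.real_source_state_historyEvent hγ.le,
      h.real_source_state_historyEvent hγ.le, signalLaw_informative, signalLaw_informative,
      sourcePrior]
    field_simp
  -- Conditioning on the informative source makes the public belief about `θ` a martingale equal to
  -- `w false t / (w true t + w false t)` along the realized actions.
  have hlim := tendsto_ae_condExp (μ := P[|{x | ω x = true}])
    (ℱ := publicFiltration f h.measurable_signal)
    (Set.indicator {x | θ x = false} fun _ => (1 : ℝ))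
  have hconv : ∀ᵐ x ∂(P[|{x | ω x = true}]), x ∈ convergenceEvent f s := by
    filter_upwards [hlim] with x hx
    have hpath := h.isThresholdPath hf hγ hm hv hv₀ (action f fun k => s k x)
    refine hpath.exists_eventually_eq hm hv (hx.congr fun t => ?_)
    have hev : (fun y => history f (fun k => s k y) t) ⁻¹' {history f (fun k => s k x) t} =
        historyEvent f s (action f fun k => s k x) t := by
      rw [historyEvent, history_eq_initialActions f (fun k => s k x)]
    have hp1 := hpath.pos true t
    have hp2 := hpath.pos false t
    refine (condExp_indicator_comap_apply (measurable_history f h.measurable_signal t)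
      (h.measurableSet_state false) ?_).trans ?_
    · rw [hev, htotal]
      positivity
    · rw [hev, htotal, hstate]
      field_simp
  have hnull : (P[|{x | ω x = true}]) (convergenceEvent f s)ᶜ = 0 := hconv
  rw [cond_apply (h.measurableSet_source true), mul_eq_zero, ENNReal.inv_eq_zero] at hnull
  exact hnull.resolve_left (measure_ne_top _ _)

/-- Learning holds if uninformative signals have the larger variance: the observer infers the
source from whether the actions converge. -/
lemma asymptoticLearning
    (h : IsModel P γ (gaussianReal (m true) v) (gaussianReal (m false) v) (gaussianReal m₀ v₀)
      θ ω s) (hf : IsEquilibrium P θ s f) (hγ : γ ∈ Set.Ioo (0 : ℝ) 1) (hm : m true ≠ m false)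
    (hv : 0 < v) (hvv₀ : v < v₀) : AsymptoticLearning P ω s f := by
  have h1 := measure_eq_zero_iff_ae_notMem.1
    (h.measure_informative_diff_convergenceEvent hf hγ.1 hm hv (hv.trans hvv₀))
  have h0 := measure_eq_zero_iff_ae_notMem.1
    (h.measure_uninformative_inter_convergenceEvent hf hγ hm hv hvv₀)
  set g : Ω → ℝ := Set.indicator {x | ω x = true} fun _ => 1 with hg
  have hgeq : g =ᵐ[P] (convergenceEvent f s).indicator fun _ => 1 := by
    filter_upwards [h1, h0] with x hx1 hx0
    have hiff : x ∈ {x | ω x = true} ↔ x ∈ convergenceEvent f s := by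
      refine ⟨fun hωx => ?_, fun hx => ?_⟩
      · by_contra hx
        exact hx1 ⟨hωx, hx⟩
      · by_contra hωx
        exact hx0 ⟨Bool.eq_false_of_not_eq_true hωx, hx⟩
    by_cases hx : x ∈ convergenceEvent f s
    · rw [hg, Set.indicator_of_mem (hiff.2 hx), Set.indicator_of_mem hx]
    · rw [hg, Set.indicator_of_notMem (mt hiff.1 hx), Set.indicator_of_notMem hx]
  have hle : ⨆ t, (publicFiltration f h.measurable_signal t : MeasurableSpace Ω) ≤
      (inferInstance : MeasurableSpace Ω) :=
    iSup_le fun t => (publicFiltration f h.measurable_signal).le t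
  have hmeas := measurableSet_convergenceEvent f h.measurable_signal
  -- The indicator of the informative source agrees almost surely with that of an event determined
  -- by the whole action sequence, so it is its own limiting conditional expectation.
  have hcond : P[g | ⨆ t, publicFiltration f h.measurable_signal t] =ᵐ[P] g := by
    refine (condExp_congr_ae hgeq).trans ?_
    rw [condExp_of_stronglyMeasurable hle
      (StronglyMeasurable.indicator stronglyMeasurable_const hmeas)
      (integrable_indicator_one (hle _ hmeas))]
    exact hgeq.symm
  intro i
  have hlim := tendsto_ae_condExp (μ := P) (ℱ := publicFiltration f h.measurable_signal) g
  have hall : ∀ᵐ x ∂P, Tendsto (fun t => observerBelief P ω s f t x) atTop (𝓝 (g x)) := by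
    filter_upwards [hlim, hcond] with x hx hx'
    rwa [hx'] at hx
  filter_upwards [cond_absolutelyContinuous.ae_le hall, ae_cond_mem (h.measurableSet_source i)]
    with x hx hxi
  have hxi' : ω x = i := hxi
  have : g x = if i = true then 1 else 0 := by
    simp [hg, Set.indicator_apply, hxi']
  rwa [this] at hx

/-- Learning fails if uninformative signals have the smaller variance: an immediate herd is
possible under both states of the source, and does not reveal which of them holds. -/
lemma not_asymptoticLearning
    (h : IsModel P γ (gaussianReal (m true) v) (gaussianReal (m false) v) (gaussianReal m₀ v₀)
      θ ω s) (hf : IsEquilibrium P θ s f) (hγ : γ ∈ Set.Ioo (0 : ℝ) 1) (hm : m true ≠ m false)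
    (hv₀ : 0 < v₀) (hvv₀ : v₀ < v) : ¬ AsymptoticLearning P ω s f := by
  intro hlearn
  have hv := hv₀.trans hvv₀
  have hγ0 := hγ.1
  have hγ1 : 0 < 1 - γ := sub_pos.2 hγ.2
  set c : ℕ → State := fun _ => true with hc
  obtain ⟨ε, hε, hle⟩ := (h.isThresholdPath hf hγ.1 hm hv hv₀ c).exists_le_of_const hm hv₀ hvv₀
    (a := true) fun _ => rfl
  have htrue (t : ℕ) : γ / 2 * ε ≤ P.real ({x | ω x = true} ∩ historyEvent f s c t) := by
    rw [h.real_source_inter, h.real_source_state_historyEvent hγ.1.le, signalLaw_informative,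
      sourcePrior]
    have h2 := mul_le_mul_of_nonneg_left (hle t).1 (half_pos hγ0).le
    have : 0 ≤ P.real ({x | ω x = true ∧ θ x = false} ∩ historyEvent f s c t) :=
      measureReal_nonneg
    linarith
  have hfalse (t : ℕ) : (1 - γ) * ε ≤ P.real ({x | ω x = false} ∩ historyEvent f s c t) := by
    rw [h.real_source_inter, h.real_source_state_historyEvent hγ.1.le,
      h.real_source_state_historyEvent hγ.1.le, signalLaw_uninformative, signalLaw_uninformative,
      sourcePrior]
    have h2 := mul_le_mul_of_nonneg_left (hle t).2 hγ1.le
    linarith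
  -- The herd events decrease in `t` and their probabilities have a uniform lower bound, so
  -- continuity from above gives the infinite herd positive probability.
  have hherd : P ({x | ω x = false} ∩ ⋂ t, historyEvent f s c t) ≠ 0 := by
    have hlim := tendsto_measure_iInter_atTop (μ := P)
      (s := fun t => {x | ω x = false} ∩ historyEvent f s c t)
      (fun t => ((h.measurableSet_source false).inter
        (measurableSet_historyEvent f h.measurable_signal c t)).nullMeasurableSet)
      (fun t t' htt' => Set.inter_subset_inter_right _ (historyEvent_antitone f s c htt'))
      ⟨0, measure_ne_top _ _⟩
    rw [← Set.inter_iInter] at hlim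
    have hge := ge_of_tendsto' hlim fun t =>
      (ENNReal.ofReal_le_iff_le_toReal (measure_ne_top _ _)).2 (hfalse t)
    exact ((ENNReal.ofReal_pos.2 (mul_pos hγ1 hε)).trans_le hge).ne'
  have hsrc : P {x | ω x = false} ≠ 0 := fun h0 =>
    hherd (measure_mono_null Set.inter_subset_left h0)
  have hherd' : (P[|{x | ω x = false}]) (⋂ t, historyEvent f s c t) ≠ 0 :=
    (cond_pos_of_inter_ne_zero (h.measurableSet_source false) hherd).ne'
  obtain ⟨x, hx, hxlim⟩ := ((frequently_ae_mem_iff.2 hherd').and_eventually (hlearn false)).exists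
  simp only [Bool.false_eq_true, if_false] at hxlim
  -- The belief is the ratio of the probability of an informative source with a herd to that of a
  -- herd. The denominator is at most 1, so the numerator's bound `htrue` suffices.
  have hbound (t : ℕ) : γ / 2 * ε ≤ observerBelief P ω s f t x := by
    have hxt : history f (fun k => s k x) t = initialActions c t := Set.mem_iInter.1 hx t
    have hev : (fun y => history f (fun k => s k y) t) ⁻¹' {history f (fun k => s k x) t} =
        historyEvent f s c t := by rw [hxt, historyEvent]
    have hpos : 0 < P.real (historyEvent f s c t) :=
      ((mul_pos (half_pos hγ0) hε).trans_le (htrue t)).trans_le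
        (measureReal_mono Set.inter_subset_right)
    have hval := condExp_indicator_comap_apply (μ := P) (x := x)
      (measurable_history f h.measurable_signal t) (h.measurableSet_source true)
      (by rw [hev]; exact hpos.ne')
    rw [hev] at hval
    refine (htrue t).trans ?_
    rw [observerBelief, hval]
    exact le_div_self measureReal_nonneg hpos measureReal_le_one
  exact (mul_pos (half_pos hγ0) hε).not_ge (ge_of_tendsto' hxlim hbound)

end IsModel

end GaussianModel

end SocialLearning

theorem corollary1 {Ω : Type*} [MeasurableSpace Ω] (P : Measure Ω) [IsProbabilityMeasure P]
    (γ : ℝ) (hγ : γ ∈ Set.Ioo (0 : ℝ) 1)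
    (mg mb m0 : ℝ) (hm : mg ≠ mb) (σ τ : ℝ≥0) (hσ : 0 < σ) (hτ : 0 < τ)
    (θ : Ω → SocialLearning.State) (ω : Ω → SocialLearning.Source) (s : ℕ → Ω → ℝ)
    (hmodel : SocialLearning.IsModel P γ (gaussianReal mg (σ ^ 2)) (gaussianReal mb (σ ^ 2))
      (gaussianReal m0 (τ ^ 2)) θ ω s)
    (f : SocialLearning.StrategyProfile ℝ) (hf : SocialLearning.IsEquilibrium P θ s f) :
    (σ < τ → SocialLearning.AsymptoticLearning P ω s f) ∧
      (τ < σ → ¬ SocialLearning.AsymptoticLearning P ω s f) := by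
  let m : SocialLearning.State → ℝ := fun a => cond a mg mb
  exact ⟨fun h => SocialLearning.IsModel.asymptoticLearning (m := m) hmodel hf hγ hm
      (pow_pos hσ 2) (pow_lt_pow_left₀ h hσ.le two_ne_zero),
    fun h => SocialLearning.IsModel.not_asymptoticLearning (m := m) hmodel hf hγ hm
      (pow_pos hτ 2) (pow_lt_pow_left₀ h hτ.le two_ne_zero)⟩
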